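/- Let $n, f \ge 0$ be integers with $n > 2f$. Then every task for $n$ processes that is solvable in $\mathrm{AMP}_f$ is solvable in $\mathrm{SFHO}_f$. The notions are as follows. *Tasks.* A task $T = (\mathcal I, \mathcal O, \Delta)$ consists of a set $\mathcal I$ of input vectors $(I_1,\dots,I_n)$, a set $\mathcal O$ of output vectors $(O_1,\dots,O_n)$ whose entries may also be $\bot$ (undecided), and a total relation $\Delta \subseteq \mathcal I \times \mathcal O$ such that $(I,O)\in\Delta$ implies $(I,O')\in\Delta$ for every $O'$ obtained from $O$ by replacing some entries by $\bot$. *Protocols.* A protocol consists of $n$ deterministic automata $p_1,\dots,p_n$ (with arbitrary, possibly infinite, state and message spaces, and possibly with different transition functions) that communicate by broadcasting messages to all processes including the sender. The initial state of $p_i$ is determined by its input $I_i$; each process decides on an output at most once, and its output is $\bot$ if it never decides. A protocol solves $T$ in a model if in each run of the model with input vector $I\in\mathcal I$ and resulting output vector $O$ we have $(I,O)\in\Delta$, and $O_i=\bot$ only if $p_i$ is faulty in that run. A task is solvable in a model if some protocol solves it there. *The model $\mathrm{AMP}_f$.* Processes take atomic steps in an arbitrary order; in a step a process receives one message or no message,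 computes, and broadcasts one message. A process is faulty if it takes only finitely many steps. The runs are those in which: at most $f$ processes are faulty; every received message was sent before; no message is received more than once by the same process; every message sent by a non-faulty process is received by all non-faulty processes; and every message sent by a faulty process, except possibly its last one, is received by all non-faulty processes. *The model $\mathrm{SFHO}_f$.* Processes proceed in synchronous rounds; in each round every process broadcasts a message, then receives the set of round messages of the processes it hears from in this round, then computes. The runs are those in which in each round every process hears from itself and from all but at most $f$ processes. For a process $p_i$ and rounds $r\le s$ let $\mathrm{Reach}_i(r,r)=\{p_i\}$ and, for $s>r$, let $\mathrm{Reach}_i(r,s)$ be the set of processes that hear in round $s-1$ from some process of $\mathrm{Reach}_i(r,s-1)$. The faulty processes are the silenced ones: those $p_i$ for which there is a round $r$ with $\bigl|\bigcup_{s\ge r}\mathrm{Reach}_i(r,s)\bigr|\le f$. -/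

import Mathlib

universe u

namespace MsgPassing

/-! ### Tasks -/

/-- A task for `n` processes. The value `none` in an output vector stands for an undecided
process. -/
structure Task (n : ℕ) (In Out : Type u) where
  /-- the set of input vectors -/
  inputs : Set (Fin n → In)
  /-- the set of output vectors -/
  outputs : Set (Fin n → Option Out)
  /-- the input-output relation -/
  Δ : (Fin n → In) → (Fin n → Option Out) → Prop
  /-- the relation is between input vectors and output vectors -/
  Δ_mem : ∀ I O, Δ I O → I ∈ inputs ∧ O ∈ outputs
  /-- the relation is total -/
  Δ_total : ∀ I ∈ inputs, ∃ O, Δ I O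
  /-- entries of an allowed output vector may be replaced by "undecided" -/
  Δ_erase : ∀ I O O', Δ I O → (∀ i, O' i = O i ∨ O' i = none) → Δ I O'

/-! ### Protocols -/

/-- A protocol: `n` deterministic automata with arbitrary (infinite) state and message spaces.
In a receive event a process obtains an element of `Rcv Msg`: we use `Rcv = Option` (one message
or no message) in the asynchronous model, and `Rcv = Set` (a set of messages) in the round-based
model. All automata draw their states from one type, but their transitions depend on the process,
so that processes may have hard-coded identifiers. -/
structure Protocol (n : ℕ) (In Out : Type u) (Rcv : Type u → Type u) where
  /-- local states -/
  State : Type u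
  /-- messages -/
  Msg : Type u
  /-- initial state of a process with a given input -/
  init : Fin n → In → State
  /-- new local state after a receive event and the subsequent local computation -/
  trans : Fin n → State → Rcv Msg → State
  /-- the message that a process in a given state broadcasts when it sends -/
  msg : Fin n → State → Msg
  /-- the decision recorded in a local state, if there is one -/
  dec : Fin n → State → Option Out
  /-- a process decides at most once: a decision is never changed or withdrawn -/
  dec_once : ∀ i s r o, dec i s = some o → dec i (trans i s r) = some o

/-- The output of a process whose successively recorded decisions are `d 0, d 1, …`: the value
that it decides if it ever decides, and `none` otherwise. -/
noncomputable def outputOf {Out : Type u} (d : ℕ → Option Out) : Option Out :=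
  open Classical in if h : ∃ t, (d t).isSome then d (Nat.find h) else none

/-! ### The asynchronous message-passing model with at most `f` faulty processes -/

/-- What happens at the successive times `0, 1, 2, …`.
* `event t = none`: nothing happens at time `t` (so finite executions are included);
* `event t = some (i, none)`: process `i` takes a step in which it receives no message;
* `event t = some (i, some s)`: process `i` takes a step in which it receives the message
  that was broadcast in the step at time `s`.
In a step a process receives, then computes, and then broadcasts one message. -/
structure AMPSchedule (n : ℕ) where
  /-- the event at each time -/
  event : ℕ → Option (Fin n × Option ℕ)

namespace AMPSchedule

variable {n : ℕ} (S : AMPSchedule n)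

/-- Process `i` takes a step at time `t`. -/
def StepsAt (i : Fin n) (t : ℕ) : Prop := ∃ src, S.event t = some (i, src)

/-- At time `t`, process `i` receives the message broadcast at time `s`. -/
def ReceivesAt (i : Fin n) (s t : ℕ) : Prop := S.event t = some (i, some s)

/-- A process is faulty if it takes only finitely many steps. -/
def Faulty (i : Fin n) : Prop := {t | S.StepsAt i t}.Finite

/-- The schedules of the asynchronous model with at most `f` faulty processes. -/
structure Valid (f : ℕ) : Prop where
  /-- at most `f` processes are faulty -/
  faulty_le : {i | S.Faulty i}.ncard ≤ f
  /-- every received message was sent before -/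
  integrity : ∀ i s t, S.ReceivesAt i s t → s < t ∧ ∃ j, S.StepsAt j s
  /-- no message is received twice by the same process -/
  no_duplicates : ∀ i s t t', S.ReceivesAt i s t → S.ReceivesAt i s t' → t = t'
  /-- messages sent by a non-faulty process are received by all non-faulty processes -/
  nonfaulty_liveness : ∀ i j s, ¬ S.Faulty i → ¬ S.Faulty j → S.StepsAt i s →
    ∃ t, S.ReceivesAt j s t
  /-- all messages but the last one sent by a faulty process are received by all non-faulty
  processes -/
  faulty_quasi_liveness : ∀ i j s, S.Faulty i → ¬ S.Faulty j → S.StepsAt i s →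
    (∃ s', s < s' ∧ S.StepsAt i s') → ∃ t, S.ReceivesAt j s t

end AMPSchedule

/-- A configuration of the asynchronous system: the local states, and the message broadcast at
each past time. -/
structure AMPConfig (n : ℕ) (State Msg : Type u) where
  /-- local states -/
  loc : Fin n → State
  /-- the message broadcast at a given time, if there was one -/
  sent : ℕ → Option Msg

namespace Protocol

variable {n : ℕ} {In Out : Type u}

/-- The configuration before time `t` in the run with input vector `I` and schedule `S`. -/
def ampRun (P : Protocol n In Out Option) (I : Fin n → In) (S : AMPSchedule n) :
    ℕ → AMPConfig n P.State P.Msg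
  | 0 => ⟨fun i => P.init i (I i), fun _ => none⟩
  | t + 1 =>
    let c := ampRun P I S t
    match S.event t with
    | none => c
    | some (i, src) =>
      let s' := P.trans i (c.loc i) (src.bind c.sent)
      ⟨Function.update c.loc i s', Function.update c.sent t (some (P.msg i s'))⟩

/-- The output vector of a run in the asynchronous model. -/
noncomputable def ampOutput (P : Protocol n In Out Option) (I : Fin n → In)
    (S : AMPSchedule n) : Fin n → Option Out :=
  fun i => outputOf fun t => P.dec i ((P.ampRun I S t).loc i)

/-- The protocol solves the task in the asynchronous model with at most `f` faults. -/
def SolvesAMP (P : Protocol n In Out Option) (f : ℕ) (T : Task n In Out) : Prop :=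
  ∀ I ∈ T.inputs, ∀ S : AMPSchedule n, S.Valid f →
    T.Δ I (P.ampOutput I S) ∧ ∀ i, P.ampOutput I S i = none → S.Faulty i

end Protocol

/-! ### The silenced-faulty Heard-Of model with at most `f` message omissions -/

/-- A schedule of the round-based model: `heard r i` is the set of processes whose round-`r`
message is received by process `i` (in round `r`). Rounds are numbered from `0`. -/
structure HOSchedule (n : ℕ) where
  /-- the heard-of sets -/
  heard : ℕ → Fin n → Finset (Fin n)

namespace HOSchedule

variable {n : ℕ} (S : HOSchedule n)

/-- In each round, every process hears from itself and misses at most `f` messages. -/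
def Valid (f : ℕ) : Prop := ∀ r i, i ∈ S.heard r i ∧ (S.heard r i)ᶜ.card ≤ f

/-- The set of processes that receive a message from process `j` in round `r`. -/
def rcv (j : Fin n) (r : ℕ) : Set (Fin n) := {k | j ∈ S.heard r k}

/-- `S.reach i r d` is the reach of process `i` between the rounds `r` and `r + d`. -/
def reach (i : Fin n) (r : ℕ) : ℕ → Set (Fin n)
  | 0 => {i}
  | d + 1 => ⋃ j ∈ reach i r d, S.rcv j (r + d)

/-- The reach of process `i` starting from round `r`. -/
def reachInf (i : Fin n) (r : ℕ) : Set (Fin n) := ⋃ d, S.reach i r d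

/-- Process `i` is silenced if, from some round on, its reach has at most `f` elements. -/
def Silenced (f : ℕ) (i : Fin n) : Prop := ∃ r, (S.reachInf i r).ncard ≤ f

end HOSchedule

namespace Protocol

variable {n : ℕ} {In Out : Type u}

/-- The local states before round `r` in the run with input vector `I` and schedule `S`. In each
round every process broadcasts, then receives the set of messages of those it hears from, and
then computes its new state. -/
def hoRun (Q : Protocol n In Out Set) (I : Fin n → In) (S : HOSchedule n) :
    ℕ → Fin n → Q.State
  | 0 => fun i => Q.init i (I i)
  | r + 1 => fun i =>
    Q.trans i (hoRun Q I S r i) {m | ∃ j ∈ S.heard r i, m = Q.msg j (hoRun Q I S r j)}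

/-- The output vector of a run in the round-based model. -/
noncomputable def hoOutput (Q : Protocol n In Out Set) (I : Fin n → In)
    (S : HOSchedule n) : Fin n → Option Out :=
  fun i => outputOf fun r => Q.dec i (Q.hoRun I S r i)

/-- The protocol solves the task in the round-based model with at most `f` omissions per process
and round, where exactly the silenced processes count as faulty. -/
def SolvesSFHO (Q : Protocol n In Out Set) (f : ℕ) (T : Task n In Out) : Prop :=
  ∀ I ∈ T.inputs, ∀ S : HOSchedule n, S.Valid f →
    T.Δ I (Q.hoOutput I S) ∧ ∀ i, Q.hoOutput I S i = none → S.Silenced f i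

end Protocol

/-- Solvability in the asynchronous message-passing model with at most `f` faulty processes. -/
def SolvableAMP {n : ℕ} {In Out : Type u} (f : ℕ) (T : Task n In Out) : Prop :=
  ∃ P : Protocol n In Out Option, P.SolvesAMP f T

/-- Solvability in the silenced-faulty Heard-Of model with at most `f` message omissions. -/
def SolvableSFHO {n : ℕ} {In Out : Type u} (f : ℕ) (T : Task n In Out) : Prop :=
  ∃ Q : Protocol n In Out Set, Q.SolvesSFHO f T

end MsgPassing

namespace MsgPassing

/-! ### Decisions -/

/-! Each round-based process simulates its asynchronous automaton and relays in every round all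
simulated messages it knows. It simulates a further step only in a round in which it hears from more
than `f` processes that know its last message (`Sim.Ready`).

This guard yields quasi-liveness: a process misses at most `f` messages per round, so what more than
`f` processes know is known to all one round later (`Sim.known_all`). Hence every message except a
sender's last reaches everyone, and receiving the oldest available message first ensures fair
delivery (`Sim.exists_src_eq`).

The guard does not block a process that is not silenced: its last message spreads along its reach to
more than `f` processes, then to all, and `n - f > f` of them are heard (`Sim.infinite_active`). So
faulty processes of the simulated run are silenced, and at most `f` processes are silenced
(`HOSchedule.Valid.ncard_silenced_le`). The simulated schedule is therefore valid, and its run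
produces the same outputs (`Sim.ampOutput_eq`). -/

theorem outputOf_eq_of_range_eq {Out : Type u} {d d' : ℕ → Option Out}
    (hd : ∀ t o, d t = some o → d (t + 1) = some o)
    (h₁ : ∀ t, ∃ r, d' t = d r) (h₂ : ∀ r, ∃ t, d r = d' t) : outputOf d' = outputOf d := by
  have pers : ∀ t o, d t = some o → ∀ t' ≥ t, d t' = some o := by
    intro t o h t' ht'
    induction t', ht' using Nat.le_induction with
    | base => exact h
    | succ k _ ih => exact hd _ _ ih
  -- Decisions in `d` persist, so at most one value is ever recorded; the index at which it is first
  -- found is irrelevant.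
  have uniq : ∀ t t', (d t).isSome → (d t').isSome → d t = d t' := by
    intro t t' h h'
    obtain ⟨o, ho⟩ := Option.isSome_iff_exists.1 h
    obtain ⟨o', ho'⟩ := Option.isSome_iff_exists.1 h'
    have hmax := pers t o ho (max t t') (le_max_left _ _)
    rw [pers t' o' ho' (max t t') (le_max_right _ _)] at hmax
    rw [ho, ho', hmax]
  by_cases h : ∃ t, (d t).isSome
  · have h' : ∃ t, (d' t).isSome := by
      obtain ⟨r, hr⟩ := h
      obtain ⟨t, ht⟩ := h₂ r
      exact ⟨t, ht ▸ hr⟩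
    classical
    unfold outputOf
    rw [dif_pos h, dif_pos h']
    obtain ⟨r, hr⟩ := h₁ (Nat.find h')
    have := Nat.find_spec h'
    rw [hr] at this ⊢
    exact uniq _ _ this (Nat.find_spec h)
  · have h' : ¬ ∃ t, (d' t).isSome := by
      rintro ⟨t, ht⟩
      obtain ⟨r, hr⟩ := h₁ t
      exact h ⟨r, hr ▸ ht⟩
    unfold outputOf
    rw [dif_neg h, dif_neg h']

/-! ### Reach and silenced processes -/

namespace HOSchedule

variable {n : ℕ} {S : HOSchedule n} {f : ℕ}

theorem reach_trans {i j : Fin n} {r d : ℕ} (hj : j ∈ S.reach i r d) (e : ℕ) :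
    S.reach j (r + d) e ⊆ S.reach i r (d + e) := by
  induction e with
  | zero => simpa [reach] using hj
  | succ e ih =>
    intro k hk
    simp only [reach, Set.mem_iUnion] at hk
    obtain ⟨l, hl, hk⟩ := hk
    rw [← Nat.add_assoc]
    simp only [reach, Set.mem_iUnion]
    exact ⟨l, ih hl, by rwa [← Nat.add_assoc]⟩

theorem reachInf_subset {i j : Fin n} {r d : ℕ} (hj : j ∈ S.reach i r d) :
    S.reachInf j (r + d) ⊆ S.reachInf i r := by
  intro k hk
  obtain ⟨e, he⟩ := Set.mem_iUnion.1 hk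
  exact Set.mem_iUnion.2 ⟨d + e, reach_trans hj e he⟩

theorem Valid.self_mem_reach (hS : S.Valid f) (i : Fin n) (r d : ℕ) : i ∈ S.reach i r d := by
  induction d with
  | zero => simp [reach]
  | succ d ih =>
    simp only [reach, Set.mem_iUnion]
    exact ⟨i, ih, (hS _ _).1⟩

theorem Valid.reachInf_antitone (hS : S.Valid f) (i : Fin n) : Antitone (S.reachInf i) := by
  intro r r' h
  obtain ⟨d, rfl⟩ := Nat.exists_eq_add_of_le h
  exact reachInf_subset (hS.self_mem_reach i r d)

theorem mem_reach_one {i k : Fin n} {r : ℕ} (h : i ∈ S.heard r k) : k ∈ S.reach i r 1 := by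
  simp only [reach, Set.mem_iUnion]
  exact ⟨i, by simp, h⟩

theorem Valid.le_card_heard (hS : S.Valid f) (r : ℕ) (i : Fin n) : n ≤ (S.heard r i).card + f := by
  have h := (hS r i).2
  have h' := Finset.card_add_card_compl (S.heard r i)
  rw [Fintype.card_fin] at h'
  omega

/-- From some round on, the reaches of all silenced processes are small. -/
theorem Valid.exists_round_reachInf_le (hS : S.Valid f) :
    ∃ R, ∀ i, S.Silenced f i → (S.reachInf i R).ncard ≤ f := by
  have h : ∀ i, ∃ r, S.Silenced f i → (S.reachInf i r).ncard ≤ f := by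
    intro i
    by_cases hi : S.Silenced f i
    · exact ⟨hi.choose, fun _ => hi.choose_spec⟩
    · exact ⟨0, fun h => absurd h hi⟩
  choose r hr using h
  refine ⟨Finset.univ.sup r, fun i hi => le_trans (Set.ncard_le_ncard ?_ (Set.toFinite _)) (hr i hi)⟩
  exact hS.reachInf_antitone i (Finset.le_sup (Finset.mem_univ i))

/-- A process that is not silenced cannot hear from a silenced one once all silenced reaches are
small, and it misses at most `f` processes. That such a process exists follows by counting the
messages of one round. -/
theorem Valid.ncard_silenced_le (hS : S.Valid f) (hnf : 2 * f < n) :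
    {i | S.Silenced f i}.ncard ≤ f := by
  classical
  obtain ⟨R, hR⟩ := hS.exists_round_reachInf_le
  by_cases hall : ∀ i, S.Silenced f i
  · exfalso
    -- Double count the pairs (sender, receiver) of round `R`: each sender is heard by at most `f`
    -- processes, but each receiver hears at least `n - f ≥ f + 1`.
    have count := Finset.sum_card_bipartiteAbove_eq_sum_card_bipartiteBelow
      (s := (Finset.univ : Finset (Fin n))) (t := (Finset.univ : Finset (Fin n)))
      (fun i k => i ∈ S.heard R k)
    have upper : ∑ i : Fin n, (Finset.bipartiteAbove (fun i k => i ∈ S.heard R k)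
        Finset.univ i).card ≤ n * f := by
      calc _ ≤ ∑ _i : Fin n, f := by
            refine Finset.sum_le_sum fun i _ => le_trans ?_ (hR i (hall i))
            rw [← Set.ncard_coe_finset]
            refine Set.ncard_le_ncard ?_ (Set.toFinite _)
            intro k hk
            have hk : i ∈ S.heard R k := by simpa [Finset.bipartiteAbove] using hk
            exact Set.mem_iUnion.2 ⟨1, mem_reach_one hk⟩
        _ = n * f := by simp
    have lower : n * (f + 1) ≤ ∑ k : Fin n, (Finset.bipartiteBelow (fun i k => i ∈ S.heard R k)
        Finset.univ k).card := by
      calc n * (f + 1) = ∑ _k : Fin n, (f + 1) := by simp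
        _ ≤ _ := by
            refine Finset.sum_le_sum fun k _ => ?_
            have h := hS.le_card_heard R k
            have : Finset.bipartiteBelow (fun i k => i ∈ S.heard R k) Finset.univ k
                = S.heard R k := by
              ext; simp [Finset.bipartiteBelow]
            rw [this]
            omega
    rw [← count] at lower
    nlinarith
  · push Not at hall
    obtain ⟨k, hk⟩ := hall
    refine le_trans ?_ (hS R k).2
    rw [← Set.ncard_coe_finset]
    refine Set.ncard_le_ncard ?_ (Set.toFinite _)
    intro i hi
    simp only [Finset.coe_compl, Set.mem_compl_iff, Finset.mem_coe]
    intro hik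
    -- If `k` heard `i` in round `R`, its reach from `R + 1` would lie in the small reach of `i`.
    refine hk ⟨R + 1, le_trans (Set.ncard_le_ncard ?_ (Set.toFinite _)) (hR i hi)⟩
    exact reachInf_subset (mem_reach_one hik)

/-- A set of more than `f` processes intersects every heard-of set. -/
theorem Valid.exists_mem_heard (hS : S.Valid f) {A : Set (Fin n)} (hA : f < A.ncard) (r : ℕ)
    (i : Fin n) : ∃ j ∈ A, j ∈ S.heard r i := by
  by_contra! h
  have : A.ncard ≤ ((S.heard r i)ᶜ).card := by
    rw [← Set.ncard_coe_finset]
    exact Set.ncard_le_ncard (fun j hj => by simpa using h j hj) (Set.toFinite _)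
  have := (hS r i).2
  omega

end HOSchedule

/-! ### Simulating an asynchronous protocol in the round-based model -/

/-- Local states of the simulation. The step that process `i` simulates in round `r` takes place
at the asynchronous time `r * n + i`, and messages are identified by the times of their broadcast. -/
structure SimState (State Msg : Type u) where
  /-- the number of the current round -/
  round : ℕ
  /-- the simulated local state -/
  loc : State
  /-- the messages the process has heard of, by the time of their broadcast -/
  known : ℕ → Option Msg
  /-- the messages already received in simulated steps -/
  received : Set ℕ
  /-- the time of the last simulated step -/
  last : Option ℕ

namespace Sim

variable {n : ℕ} {State Msg : Type u}

open Classical in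
/-- The simulated messages contained in a set of round messages. -/
noncomputable def merge (R : Set (Fin n × SimState State Msg)) (t : ℕ) : Option Msg :=
  if h : ∃ m, ∃ p ∈ R, p.2.known t = some m then some h.choose else none

/-- More than `f` of the received round messages come from processes that know the last
message. -/
def Ready (f : ℕ) (σ : SimState State Msg) (R : Set (Fin n × SimState State Msg)) : Prop :=
  ∀ t, σ.last = some t → f < {j | ∃ τ, (j, τ) ∈ R ∧ τ.known t ≠ none}.ncard

/-- The messages that can be received in a simulated step. -/
def available (σ : SimState State Msg) (R : Set (Fin n × SimState State Msg)) : Set ℕ :=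
  {t | t ∉ σ.received ∧ merge R t ≠ none}

open Classical in
/-- The message received in a simulated step: the oldest one available. -/
noncomputable def source (σ : SimState State Msg) (R : Set (Fin n × SimState State Msg)) :
    Option ℕ :=
  if (available σ R).Nonempty then some (sInf (available σ R)) else none

/-- The local state after a simulated step. -/
noncomputable def nextLoc (trans : State → Option Msg → State) (σ : SimState State Msg)
    (R : Set (Fin n × SimState State Msg)) : State :=
  trans σ.loc ((source σ R).bind (merge R))

theorem exists_of_merge_eq_some {R : Set (Fin n × SimState State Msg)} {t : ℕ} {m : Msg}
    (h : merge R t = some m) : ∃ p ∈ R, p.2.known t = some m := by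
  unfold merge at h
  split_ifs at h with h'
  have := h'.choose_spec
  rwa [Option.some.inj h] at this

theorem merge_ne_none {R : Set (Fin n × SimState State Msg)} {t : ℕ}
    {p : Fin n × SimState State Msg} (hp : p ∈ R) (h : p.2.known t ≠ none) : merge R t ≠ none := by
  obtain ⟨m, hm⟩ := Option.ne_none_iff_exists'.1 h
  unfold merge
  rw [dif_pos ⟨m, p, hp, hm⟩]
  simp

theorem source_mem {σ : SimState State Msg} {R : Set (Fin n × SimState State Msg)} {t : ℕ}
    (h : source σ R = some t) : t ∈ available σ R := by
  unfold source at h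
  split_ifs at h with h'
  rw [← Option.some.inj h]
  exact Nat.sInf_mem h'

theorem exists_source_le {σ : SimState State Msg} {R : Set (Fin n × SimState State Msg)} {t : ℕ}
    (h : t ∈ available σ R) : ∃ s ≤ t, source σ R = some s := by
  unfold source
  rw [if_pos ⟨t, h⟩]
  exact ⟨_, Nat.sInf_le h, rfl⟩

end Sim

open Classical in
/-- The round-based protocol that simulates an asynchronous protocol. -/
noncomputable def Protocol.sim {n : ℕ} {In Out : Type u} (P : Protocol n In Out Option) (f : ℕ) :
    Protocol n In Out Set where
  State := SimState P.State P.Msg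
  Msg := Fin n × SimState P.State P.Msg
  init i a := ⟨0, P.init i a, fun _ => none, ∅, none⟩
  trans i σ R :=
    if Sim.Ready f σ R then
      { round := σ.round + 1
        loc := Sim.nextLoc (P.trans i) σ R
        known := Function.update (Sim.merge R) (σ.round * n + i)
          (some (P.msg i (Sim.nextLoc (P.trans i) σ R)))
        received := {t | t ∈ σ.received ∨ Sim.source σ R = some t}
        last := some (σ.round * n + i) }
    else { σ with round := σ.round + 1, known := Sim.merge R }
  msg i σ := (i, σ)
  dec i σ := P.dec i σ.loc
  dec_once i σ R o h := by
    split_ifs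
    · exact P.dec_once _ _ _ _ h
    · exact h

/-! ### Spread of knowledge and progress in the simulation -/

namespace Sim

variable {n : ℕ} {In Out : Type u} (P : Protocol n In Out Option) (f : ℕ) (I : Fin n → In)
  (S : HOSchedule n)

/-- The local states of the simulation. -/
noncomputable def run (r : ℕ) (i : Fin n) : SimState P.State P.Msg := (P.sim f).hoRun I S r i

/-- The round messages received by process `i` in round `r`. -/
def inbox (r : ℕ) (i : Fin n) : Set (Fin n × SimState P.State P.Msg) :=
  {m | ∃ j ∈ S.heard r i, m = (j, run P f I S r j)}

/-- Process `i` simulates a step in round `r`. -/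
def Active (r : ℕ) (i : Fin n) : Prop := Ready f (run P f I S r i) (inbox P f I S r i)

/-- The message received in the step that process `i` simulates in round `r`. -/
noncomputable def src (r : ℕ) (i : Fin n) : Option ℕ :=
  source (run P f I S r i) (inbox P f I S r i)

open Classical in
/-- The schedule of the simulated asynchronous run. -/
noncomputable def schedule [NeZero n] : AMPSchedule n where
  event t :=
    if Active P f I S (t / n) (Fin.ofNat n t) then
      some (Fin.ofNat n t, src P f I S (t / n) (Fin.ofNat n t))
    else none

open Classical in
/-- The message broadcast at a time of the simulated asynchronous run. -/
noncomputable def sentMsg [NeZero n] (t : ℕ) : Option P.Msg :=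
  if Active P f I S (t / n) (Fin.ofNat n t) then
    some (P.msg (Fin.ofNat n t) (run P f I S (t / n + 1) (Fin.ofNat n t)).loc)
  else none

variable {P f I S}

theorem run_succ_of_active {r : ℕ} {i : Fin n} (h : Active P f I S r i) :
    run P f I S (r + 1) i =
      { round := (run P f I S r i).round + 1
        loc := nextLoc (P.trans i) (run P f I S r i) (inbox P f I S r i)
        known := Function.update (merge (inbox P f I S r i)) ((run P f I S r i).round * n + i)
          (some (P.msg i (nextLoc (P.trans i) (run P f I S r i) (inbox P f I S r i))))
        received := {t | t ∈ (run P f I S r i).received ∨ src P f I S r i = some t}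
        last := some ((run P f I S r i).round * n + i) } :=
  if_pos h

theorem run_succ_of_not_active {r : ℕ} {i : Fin n} (h : ¬ Active P f I S r i) :
    run P f I S (r + 1) i =
      { run P f I S r i with
        round := (run P f I S r i).round + 1
        known := merge (inbox P f I S r i) } :=
  if_neg h

theorem round_run (r : ℕ) (i : Fin n) : (run P f I S r i).round = r := by
  induction r with
  | zero => rfl
  | succ r ih =>
    by_cases h : Active P f I S r i
    · rw [run_succ_of_active h, ih]
    · rw [run_succ_of_not_active h, ih]

theorem mem_inbox {r : ℕ} {i j : Fin n} {τ : SimState P.State P.Msg} :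
    (j, τ) ∈ inbox P f I S r i ↔ j ∈ S.heard r i ∧ τ = run P f I S r j := by
  constructor
  · rintro ⟨j', hj', h⟩
    obtain ⟨rfl, rfl⟩ := Prod.mk.inj h
    exact ⟨hj', rfl⟩
  · rintro ⟨h, rfl⟩
    exact ⟨j, h, rfl⟩

theorem merge_inbox_ne_none {r t : ℕ} {i j : Fin n} (hj : j ∈ S.heard r i)
    (h : (run P f I S r j).known t ≠ none) : merge (inbox P f I S r i) t ≠ none :=
  merge_ne_none (p := (j, run P f I S r j)) (mem_inbox.2 ⟨hj, rfl⟩) h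

theorem known_succ_of_merge {r t : ℕ} {i : Fin n} (h : merge (inbox P f I S r i) t ≠ none) :
    (run P f I S (r + 1) i).known t ≠ none := by
  by_cases ha : Active P f I S r i
  · rw [run_succ_of_active ha]
    by_cases ht : t = (run P f I S r i).round * n + i
    · simp [ht]
    · simpa [Function.update_of_ne ht] using h
  · rw [run_succ_of_not_active ha]
    exact h

theorem known_succ {r t : ℕ} {i j : Fin n} (hj : j ∈ S.heard r i)
    (h : (run P f I S r j).known t ≠ none) : (run P f I S (r + 1) i).known t ≠ none :=
  known_succ_of_merge (merge_inbox_ne_none hj h)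

theorem known_mono (hS : S.Valid f) {r r' t : ℕ} (hr : r ≤ r') {i : Fin n}
    (h : (run P f I S r i).known t ≠ none) : (run P f I S r' i).known t ≠ none := by
  induction r', hr using Nat.le_induction with
  | base => exact h
  | succ k _ ih => exact known_succ (hS k i).1 ih

/-- Knowledge is relayed in every round, whether or not a step is simulated, so it travels along the
reach. -/
theorem known_of_mem_reach {r t d : ℕ} {i j : Fin n} (h : (run P f I S r i).known t ≠ none)
    (hj : j ∈ S.reach i r d) : (run P f I S (r + d) j).known t ≠ none := by
  induction d generalizing j with
  | zero =>
    obtain rfl : j = i := hj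
    exact h
  | succ d ih =>
    simp only [HOSchedule.reach, Set.mem_iUnion] at hj
    obtain ⟨k, hk, hj⟩ := hj
    exact known_succ hj (ih hk)

/-- A message known to more than `f` processes is known to all processes one round later. -/
theorem known_all (hS : S.Valid f) {r r' t : ℕ}
    (h : f < {j | (run P f I S r j).known t ≠ none}.ncard) (hr : r < r') (i : Fin n) :
    (run P f I S r' i).known t ≠ none := by
  obtain ⟨j, hj, hj'⟩ := hS.exists_mem_heard h r i
  exact known_mono hS hr (known_succ hj' hj)

theorem active_iff {r : ℕ} {i : Fin n} : Active P f I S r i ↔ ∀ t, (run P f I S r i).last = some t →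
    f < {j | j ∈ S.heard r i ∧ (run P f I S r j).known t ≠ none}.ncard := by
  have : ∀ t, {j | ∃ τ, (j, τ) ∈ inbox P f I S r i ∧ τ.known t ≠ none} =
      {j | j ∈ S.heard r i ∧ (run P f I S r j).known t ≠ none} := by
    intro t
    ext j
    simp only [mem_inbox, Set.mem_ofPred_eq]
    constructor
    · rintro ⟨_, ⟨h, rfl⟩, h'⟩
      exact ⟨h, h'⟩
    · rintro ⟨h, h'⟩
      exact ⟨_, ⟨h, rfl⟩, h'⟩
  simp only [Active, Ready, this]

theorem last_eq {r r' : ℕ} {i : Fin n} (h : Active P f I S r i) (hr : r < r')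
    (hno : ∀ k, r < k → k < r' → ¬ Active P f I S k i) :
    (run P f I S r' i).last = some (r * n + i) := by
  induction r', hr using Nat.le_induction with
  | base => rw [run_succ_of_active h, round_run]
  | succ k hk ih =>
    rw [run_succ_of_not_active (hno k hk (Nat.lt_succ_self k))]
    exact ih fun l h₁ h₂ => hno l h₁ (h₂.trans (Nat.lt_succ_self k))

theorem known_last (hS : S.Valid f) {r t : ℕ} {i : Fin n} (h : (run P f I S r i).last = some t) :
    (run P f I S r i).known t ≠ none := by
  induction r with
  | zero => exact absurd h (by simp [run, Protocol.hoRun, Protocol.sim])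
  | succ r ih =>
    by_cases ha : Active P f I S r i
    · rw [run_succ_of_active ha] at h ⊢
      rw [← Option.some.inj h]
      simp
    · rw [run_succ_of_not_active ha] at h
      exact known_succ (hS r i).1 (ih h)

theorem mem_received {r t : ℕ} {i : Fin n} : t ∈ (run P f I S r i).received ↔
    ∃ k < r, Active P f I S k i ∧ src P f I S k i = some t := by
  induction r with
  | zero => simp [run, Protocol.hoRun, Protocol.sim]
  | succ r ih =>
    simp only [Nat.lt_succ_iff_lt_or_eq, or_and_right, exists_or, exists_eq_left]
    by_cases ha : Active P f I S r i
    · rw [run_succ_of_active ha, Set.mem_ofPred_eq, ih]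
      simp [ha]
    · rw [run_succ_of_not_active ha, ← ih]
      simp [ha]

theorem src_injective {r r' t : ℕ} {i : Fin n} (h : Active P f I S r i)
    (h' : Active P f I S r' i) (hr : src P f I S r i = some t) (hr' : src P f I S r' i = some t) :
    r = r' := by
  rcases lt_trichotomy r r' with hlt | heq | hlt
  · exact absurd (mem_received.2 ⟨r, hlt, h, hr⟩) (source_mem hr').1
  · exact heq
  · exact absurd (mem_received.2 ⟨r', hlt, h', hr'⟩) (source_mem hr).1

/-- A message is known to all processes after its sender has simulated another step. -/
theorem exists_known_of_active_of_active (hS : S.Valid f) {r r' : ℕ} {i : Fin n}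
    (h : Active P f I S r i) (hr : r < r') (h' : Active P f I S r' i) :
    ∃ R, ∀ k ≥ R, ∀ j, (run P f I S k j).known (r * n + i) ≠ none := by
  classical
  -- At the first active round after `r`, the pending last message is still the one from round `r`,
  -- so the guard applies to it.
  have hex : ∃ k, r < k ∧ Active P f I S k i := ⟨r', hr, h'⟩
  obtain ⟨hlt, hact⟩ := Nat.find_spec hex
  have hlast := last_eq h hlt fun k h₁ h₂ h₃ => Nat.find_min hex h₂ ⟨h₁, h₃⟩
  refine ⟨Nat.find hex + 1, fun k hk j => known_all hS (r := Nat.find hex) ?_ hk j⟩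
  refine lt_of_lt_of_le (active_iff.1 hact _ hlast) (Set.ncard_le_ncard ?_ (Set.toFinite _))
  exact fun l hl => hl.2

/-- A process that simulates infinitely many steps receives every message that it knows. -/
theorem exists_src_eq {R t : ℕ} {j : Fin n} (hS : S.Valid f)
    (hk : ∀ k ≥ R, (run P f I S k j).known t ≠ none)
    (hinf : {r | Active P f I S r j}.Infinite) :
    ∃ r, Active P f I S r j ∧ src P f I S r j = some t := by
  by_contra! hno
  have hinf' : {r | Active P f I S r j ∧ R ≤ r}.Infinite := by
    refine (hinf.sdiff (Set.finite_lt_nat R)).mono ?_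
    rintro r ⟨h₁, h₂⟩
    exact ⟨h₁, not_lt.1 h₂⟩
  have hsrc : ∀ r, R ≤ r → ∃ s ≤ t, src P f I S r j = some s := by
    intro r hr
    refine exists_source_le ⟨fun h => ?_, merge_inbox_ne_none (hS r j).1 (hk r hr)⟩
    obtain ⟨k, -, h₁, h₂⟩ := mem_received.1 h
    exact hno k h₁ h₂
  choose! s hs hs' using hsrc
  -- If `t` were never received, infinitely many steps would receive pairwise distinct messages with
  -- times at most `t`.
  refine Set.infinite_of_injOn_mapsTo (f := s) ?_ (fun r hr => hs r hr.2) hinf' (Set.finite_le_nat t)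
  rintro a ⟨ha, ha'⟩ b ⟨hb, hb'⟩ hab
  exact src_injective ha hb (hs' a ha') (hab ▸ hs' b hb')

/-- Processes that are not silenced simulate infinitely many steps. -/
theorem infinite_active (hS : S.Valid f) (hnf : 2 * f < n) {i : Fin n} (hi : ¬ S.Silenced f i) :
    {r | Active P f I S r i}.Infinite := by
  intro hfin
  obtain ⟨B, hB⟩ := hfin.bddAbove
  have hno : ∀ r, B < r → ¬ Active P f I S r i := fun r hr h => absurd (hB h) (not_le.2 hr)
  have hlast : ∀ r ≥ B + 1, (run P f I S r i).last = (run P f I S (B + 1) i).last := by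
    intro r hr
    induction r, hr using Nat.le_induction with
    | base => rfl
    | succ k hk ih => rw [run_succ_of_not_active (hno k hk), ← ih]
  cases ht : (run P f I S (B + 1) i).last with
  -- Without an earlier step the guard is vacuous.
  | none => exact hno (B + 1) (Nat.lt_succ_self B) (active_iff.2 fun t h => by simp [ht] at h)
  | some t =>
    have hreach : ∀ j, ∃ R, j ∈ S.reachInf i (B + 1) → (run P f I S R j).known t ≠ none := by
      intro j
      by_cases hj : j ∈ S.reachInf i (B + 1)
      · obtain ⟨d, hd⟩ := Set.mem_iUnion.1 hj
        exact ⟨_, fun _ => known_of_mem_reach (known_last hS ht) hd⟩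
      · exact ⟨0, fun h => absurd h hj⟩
    choose R hR using hreach
    have hcard : f < {j | (run P f I S (Finset.univ.sup R) j).known t ≠ none}.ncard := by
      have hi' : f < (S.reachInf i (B + 1)).ncard := not_le.1 fun h => hi ⟨_, h⟩
      refine lt_of_lt_of_le hi' (Set.ncard_le_ncard ?_ (Set.toFinite _))
      exact fun j hj => known_mono hS (Finset.le_sup (Finset.mem_univ j)) (hR j hj)
    have hall := known_all hS hcard (r' := Finset.univ.sup R + B + 1) (by omega)
    refine hno (Finset.univ.sup R + B + 1) (by omega) (active_iff.2 fun t' ht' => ?_)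
    rw [hlast _ (by omega), ht] at ht'
    obtain rfl := Option.some.inj ht'
    have hheard := hS.le_card_heard (Finset.univ.sup R + B + 1) i
    rw [← Set.ncard_coe_finset] at hheard
    -- Everyone heard knows the message, and the heard-of set has at least `n - f > f` elements.
    refine lt_of_lt_of_le (b := (S.heard (Finset.univ.sup R + B + 1) i : Set (Fin n)).ncard)
      (by omega) (Set.ncard_le_ncard ?_ (Set.toFinite _))
    exact fun j hj => ⟨hj, hall j⟩

/-! ### The simulated run -/

section Schedule

variable [NeZero n]

theorem time_div (r : ℕ) (i : Fin n) : (r * n + i) / n = r := by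
  rw [Nat.mul_comm, Nat.mul_add_div (Nat.pos_of_ne_zero (NeZero.ne n)), Nat.div_eq_of_lt i.2,
    Nat.add_zero]

theorem time_mod (r : ℕ) (i : Fin n) : Fin.ofNat n (r * n + i) = i := by
  ext
  simp [Fin.ofNat, Nat.mod_eq_of_lt i.2]

theorem time_eq (t : ℕ) : t / n * n + (Fin.ofNat n t : Fin n) = t := Nat.div_add_mod' t n

theorem time_injective {r r' : ℕ} {i : Fin n} (h : r * n + i = r' * n + i) : r = r' := by
  rw [← time_div r i, h, time_div]

theorem event_eq_some {t : ℕ} {i : Fin n} {s : Option ℕ} :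
    (schedule P f I S).event t = some (i, s) ↔
      ∃ r, t = r * n + i ∧ Active P f I S r i ∧ src P f I S r i = s := by
  unfold schedule
  constructor
  · intro h
    simp only at h
    split_ifs at h with ha
    obtain ⟨rfl, rfl⟩ := Prod.mk.inj (Option.some.inj h)
    exact ⟨_, (time_eq t).symm, ha, rfl⟩
  · rintro ⟨r, rfl, ha, rfl⟩
    simp only [time_div, time_mod]
    exact if_pos (by rwa [time_div, time_mod])

theorem event_eq_none {r : ℕ} {i : Fin n} (h : ¬ Active P f I S r i) :
    (schedule P f I S).event (r * n + i) = none := by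
  simp only [schedule, time_div, time_mod]
  exact if_neg (by rwa [time_div, time_mod])

theorem receivesAt_iff {s t : ℕ} {i : Fin n} : (schedule P f I S).ReceivesAt i s t ↔
    ∃ r, t = r * n + i ∧ Active P f I S r i ∧ src P f I S r i = some s :=
  event_eq_some

theorem stepsAt_iff {t : ℕ} {i : Fin n} : (schedule P f I S).StepsAt i t ↔
    ∃ r, t = r * n + i ∧ Active P f I S r i := by
  simp only [AMPSchedule.StepsAt, event_eq_some]
  constructor
  · rintro ⟨_, r, h, h', -⟩
    exact ⟨r, h, h'⟩
  · rintro ⟨r, h, h'⟩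
    exact ⟨_, r, h, h', rfl⟩

theorem faulty_iff {i : Fin n} :
    (schedule P f I S).Faulty i ↔ {r | Active P f I S r i}.Finite := by
  have : {t | (schedule P f I S).StepsAt i t} =
      (fun r => r * n + i) '' {r | Active P f I S r i} := by
    ext t
    simp only [stepsAt_iff, Set.mem_image, Set.mem_ofPred_eq]
    constructor
    · rintro ⟨r, rfl, h⟩
      exact ⟨r, h, rfl⟩
    · rintro ⟨r, h, rfl⟩
      exact ⟨r, rfl, h⟩
  rw [AMPSchedule.Faulty, this]
  exact Set.finite_image_iff fun a _ b _ h => time_injective h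

theorem sentMsg_time (r : ℕ) (i : Fin n) (h : Active P f I S r i) :
    sentMsg P f I S (r * n + i) = some (P.msg i (run P f I S (r + 1) i).loc) := by
  simp only [sentMsg, time_div, time_mod]
  exact if_pos (by rwa [time_div, time_mod])

theorem sentMsg_time_of_not (r : ℕ) (i : Fin n) (h : ¬ Active P f I S r i) :
    sentMsg P f I S (r * n + i) = none := by
  simp only [sentMsg, time_div, time_mod]
  exact if_neg (by rwa [time_div, time_mod])

/-- Processes know only messages that were sent before. -/
theorem known_sound {r t : ℕ} {i : Fin n} {m : P.Msg} (h : (run P f I S r i).known t = some m) :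
    t < r * n ∧ sentMsg P f I S t = some m := by
  induction r generalizing i with
  | zero => exact absurd h (by simp [run, Protocol.hoRun, Protocol.sim])
  | succ r ih =>
    have hmerge : merge (inbox P f I S r i) t = some m →
        t < (r + 1) * n ∧ sentMsg P f I S t = some m := by
      intro h
      obtain ⟨⟨j, τ⟩, hp, hm⟩ := exists_of_merge_eq_some h
      obtain ⟨-, rfl⟩ := mem_inbox.1 hp
      obtain ⟨h₁, h₂⟩ := ih hm
      exact ⟨h₁.trans_le (Nat.mul_le_mul_right n (Nat.le_succ r)), h₂⟩
    by_cases ha : Active P f I S r i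
    · have hs := sentMsg_time r i ha
      rw [run_succ_of_active ha, round_run] at h
      dsimp only at h
      rw [run_succ_of_active ha] at hs
      by_cases ht : t = r * n + i
      · subst ht
        rw [Function.update_self] at h
        refine ⟨?_, hs.trans h⟩
        have := i.2
        rw [Nat.succ_mul]
        omega
      · rw [Function.update_of_ne ht] at h
        exact hmerge h
    · rw [run_succ_of_not_active ha] at h
      exact hmerge h

/-- This makes the choice in `merge` harmless: all copies stored under `t` agree. The bound `r * n`
precedes every time slot of round `r`, which gives integrity. -/
theorem merge_sound {r t : ℕ} {i : Fin n} {m : P.Msg} (h : merge (inbox P f I S r i) t = some m) :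
    t < r * n ∧ sentMsg P f I S t = some m := by
  obtain ⟨⟨j, τ⟩, hp, hm⟩ := exists_of_merge_eq_some h
  obtain ⟨-, rfl⟩ := mem_inbox.1 hp
  exact known_sound hm

theorem valid_schedule (hS : S.Valid f) (hnf : 2 * f < n) : (schedule P f I S).Valid f := by
  -- Covers both liveness clauses, since a non-faulty sender always has a later step.
  have live : ∀ i j s, ¬ (schedule P f I S).Faulty j → (schedule P f I S).StepsAt i s →
      (∃ s', s < s' ∧ (schedule P f I S).StepsAt i s') →
      ∃ t, (schedule P f I S).ReceivesAt j s t := by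
    rintro i j s hj hs ⟨s', hlt, hs'⟩
    obtain ⟨r, rfl, hr⟩ := stepsAt_iff.1 hs
    obtain ⟨r', rfl, hr'⟩ := stepsAt_iff.1 hs'
    have hrr : r < r' := by
      by_contra! h
      have := Nat.mul_le_mul_right n h
      omega
    obtain ⟨R, hR⟩ := exists_known_of_active_of_active hS hr hrr hr'
    obtain ⟨k, hk, hk'⟩ := exists_src_eq hS (fun k hk => hR k hk j) (fun h => hj (faulty_iff.2 h))
    exact ⟨_, receivesAt_iff.2 ⟨k, rfl, hk, hk'⟩⟩
  refine ⟨?_, ?_, ?_, ?_, fun i j s _ => live i j s⟩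
  · refine le_trans (Set.ncard_le_ncard ?_ (Set.toFinite _)) (hS.ncard_silenced_le hnf)
    intro i hi
    by_contra h
    exact infinite_active hS hnf h (faulty_iff.1 hi)
  · intro i s t h
    obtain ⟨r, rfl, -, hs⟩ := receivesAt_iff.1 h
    obtain ⟨m, hm⟩ := Option.ne_none_iff_exists'.1 (source_mem hs).2
    obtain ⟨hlt, hsent⟩ := merge_sound hm
    refine ⟨by omega, Fin.ofNat n s, stepsAt_iff.2 ⟨s / n, (time_eq s).symm, ?_⟩⟩
    by_contra ha
    rw [← time_eq (n := n) s, sentMsg_time_of_not _ _ ha] at hsent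
    cases hsent
  · intro i s t t' h h'
    obtain ⟨r, rfl, ha, hs⟩ := receivesAt_iff.1 h
    obtain ⟨r', rfl, ha', hs'⟩ := receivesAt_iff.1 h'
    rw [src_injective ha ha' hs hs']
  · intro i j s hi hj hs
    obtain ⟨s', hs', hlt⟩ := (Set.not_finite.1 hi : Set.Infinite _).exists_gt s
    exact live i j s hj hs ⟨s', hlt, hs'⟩

/-- The simulated run is the asynchronous run with the simulated schedule. -/
theorem ampRun_eq (t : ℕ) :
    (∀ r (i : Fin n), t ≤ r * n + i → r * n + i < t + n →
      (P.ampRun I (schedule P f I S) t).loc i = (run P f I S r i).loc) ∧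
    ∀ s, (P.ampRun I (schedule P f I S) t).sent s = if s < t then sentMsg P f I S s else none := by
  -- The window from `t` to `t + n - 1` holds exactly one slot per process, so `r` is the round of
  -- the next slot of `i`. Until then its local state is the one before round `r`.
  induction t with
  | zero =>
    refine ⟨fun r i _ h => ?_, fun s => by simp [Protocol.ampRun]⟩
    obtain rfl : r = 0 := by
      by_contra hr
      have := Nat.mul_le_mul_right n (Nat.one_le_iff_ne_zero.2 hr)
      omega
    rfl
  | succ t ih =>
    obtain ⟨hloc, hsent⟩ := ih
    obtain ⟨k, j, rfl⟩ : ∃ k, ∃ j : Fin n, t = k * n + j := ⟨_, _, (time_eq t).symm⟩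
    -- Shifting the window by one replaces the slot of `j` in round `k` by its slot in round `k +
    -- 1`; the other slots remain.
    have hother : ∀ r (i : Fin n), i ≠ j → k * n + j + 1 ≤ r * n + i →
        r * n + i < k * n + j + 1 + n → r * n + i < k * n + j + n := by
      intro r i hij _ h₂
      refine lt_of_le_of_ne (by omega) fun h => hij ?_
      rw [← time_mod r i, h, show k * n + (j : ℕ) + n = (k + 1) * n + j by ring, time_mod]
    have hself : ∀ r, k * n + j + 1 ≤ r * n + j → r * n + j < k * n + j + 1 + n → r = k + 1 := by
      intro r h₁ h₂
      have h₃ : k < r := by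
        by_contra! h
        have := Nat.mul_le_mul_right n h
        omega
      by_contra h
      have hmul := Nat.mul_le_mul_right n (show k + 2 ≤ r by omega)
      rw [Nat.add_mul] at hmul
      have := j.2
      omega
    have hkj := hloc k j le_rfl (Nat.lt_add_of_pos_right (Nat.pos_of_ne_zero (NeZero.ne n)))
    by_cases ha : Active P f I S k j
    · have he : (schedule P f I S).event (k * n + j) = some (j, src P f I S k j) :=
        event_eq_some.2 ⟨k, rfl, ha, rfl⟩
      have hsrc : (src P f I S k j).bind (P.ampRun I (schedule P f I S) (k * n + j)).sent =
          (src P f I S k j).bind (merge (inbox P f I S k j)) := by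
        cases hs : src P f I S k j with
        | none => rfl
        | some s =>
          obtain ⟨m, hm⟩ := Option.ne_none_iff_exists'.1 (source_mem hs).2
          obtain ⟨h₁, h₂⟩ := merge_sound hm
          rw [Option.bind_some, Option.bind_some, hsent, if_pos (by omega), hm, h₂]
      have hnext : (run P f I S (k + 1) j).loc =
          P.trans j ((P.ampRun I (schedule P f I S) (k * n + j)).loc j)
            ((src P f I S k j).bind (P.ampRun I (schedule P f I S) (k * n + j)).sent) := by
        rw [run_succ_of_active ha, hsrc, hkj]
        rfl
      simp only [Protocol.ampRun, he, ← hnext]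
      refine ⟨fun r i h₁ h₂ => ?_, fun s => ?_⟩
      · by_cases hij : i = j
        · subst hij
          rw [Function.update_self, hself r h₁ h₂]
        · rw [Function.update_of_ne hij]
          exact hloc r i (by omega) (hother r i hij h₁ h₂)
      · by_cases hs : s = k * n + j
        · subst hs
          rw [Function.update_self, if_pos (Nat.lt_succ_self _), sentMsg_time k j ha]
        · rw [Function.update_of_ne hs, hsent]
          exact if_congr (by omega) rfl rfl
    · have he := event_eq_none ha
      simp only [Protocol.ampRun, he]
      refine ⟨fun r i h₁ h₂ => ?_, fun s => ?_⟩
      · by_cases hij : i = j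
        · subst hij
          rw [hself r h₁ h₂, run_succ_of_not_active ha]
          exact hkj
        · exact hloc r i (by omega) (hother r i hij h₁ h₂)
      · by_cases hs : s = k * n + j
        · subst hs
          rw [hsent, if_neg (lt_irrefl _), if_pos (Nat.lt_succ_self _), sentMsg_time_of_not k j ha]
        · rw [hsent]
          exact if_congr (by omega) rfl rfl

/-- Rounds and asynchronous times are not aligned, but the local states of `i` pass through the same
values, which suffices because decisions persist. -/
theorem ampOutput_eq : P.ampOutput I (schedule P f I S) = (P.sim f).hoOutput I S := by
  funext i
  have hn : 0 < n := Nat.pos_of_ne_zero (NeZero.ne n)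
  refine outputOf_eq_of_range_eq (fun r o h => (P.sim f).dec_once _ _ _ _ h) (fun t => ?_)
    (fun r => ?_)
  · have hex : ∃ r, t ≤ r * n + i := ⟨t, le_add_right (Nat.le_mul_of_pos_right t hn)⟩
    classical
    -- The least round whose slot for `i` is not before `t`; minimality places this slot before `t +
    -- n`.
    refine ⟨Nat.find hex, congrArg (P.dec i)
      ((ampRun_eq t).1 (Nat.find hex) i (Nat.find_spec hex) ?_)⟩
    rcases Nat.eq_zero_or_pos (Nat.find hex) with h | h
    · rw [h]
      have := i.2
      omega
    · have hmin := Nat.find_min hex (Nat.sub_lt h Nat.one_pos)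
      obtain ⟨k, hk⟩ : ∃ k, Nat.find hex = k + 1 := ⟨_, (Nat.sub_add_cancel h).symm⟩
      rw [hk, Nat.add_sub_cancel] at hmin
      rw [hk, Nat.add_mul]
      omega
  · exact ⟨r * n + i, congrArg (P.dec i)
      ((ampRun_eq (r * n + i)).1 r i le_rfl (Nat.lt_add_of_pos_right hn)).symm⟩

end Schedule

end Sim

end MsgPassing

theorem mainTheorem8 {In Out : Type u} (n f : ℕ) (hnf : 2 * f < n)
    (T : MsgPassing.Task n In Out) (hT : MsgPassing.SolvableAMP f T) :
    MsgPassing.SolvableSFHO f T := by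
  obtain ⟨P, hP⟩ := hT
  have : NeZero n := ⟨by omega⟩
  refine ⟨P.sim f, fun I hI S hS => ?_⟩
  obtain ⟨h₁, h₂⟩ := hP I hI _ (MsgPassing.Sim.valid_schedule (I := I) (P := P) hS hnf)
  rw [MsgPassing.Sim.ampOutput_eq] at h₁ h₂
  refine ⟨h₁, fun i hi => ?_⟩
  by_contra h
  exact MsgPassing.Sim.infinite_active hS hnf h (MsgPassing.Sim.faulty_iff.1 (h₂ i hi))
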